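/- A Boolean algebra with an operator (BAO) is a Boolean algebra $B$ equipped with a map $\Diamond\colon B\to B$ that preserves finite joins, i.e. $\Diamond 0=0$ and $\Diamond(a\vee b)=\Diamond a\vee\Diamond b$ for all $a,b\in B$. A closure algebra is a BAO such that $a\le\Diamond a$ and $\Diamond\Diamond a\le\Diamond a$ for all $a\in B$. Let $\mathsf{CBAO}$ be the category whose objects are the BAOs whose underlying Boolean algebra is complete, and whose morphisms are the complete BAO homomorphisms, i.e. the Boolean algebra homomorphisms $\varphi$ that preserve arbitrary joins and meets and satisfy $\varphi(\Diamond a)=\Diamond\varphi(a)$ for all $a$. Let $\mathsf{CCA}$ be the full subcategory of $\mathsf{CBAO}$ consisting of closure algebras. **Theorem.** The category $\mathsf{CBAO}$ does not have binary coproducts: there are two objects of $\mathsf{CBAO}$ that have no coproduct in $\mathsf{CBAO}$. Likewise, the category $\mathsf{CCA}$ does not have binary coproducts: there are two objects of $\mathsf{CCA}$ that have no coproduct in $\mathsf{CCA}$. -/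

import Mathlib

open CategoryTheory CategoryTheory.Limits

universe u

/-- A complete Boolean algebra with an operator: a complete Boolean algebra together with a unary
operation `dia` that preserves finite joins (the empty join included). The operator is not
required to preserve infinite joins. The one-element algebra is allowed. -/
structure CBAO : Type (u + 1) where
  carrier : Type u
  [str : CompleteBooleanAlgebra carrier]
  dia : carrier → carrier
  dia_bot : dia ⊥ = ⊥
  dia_sup : ∀ a b : carrier, dia (a ⊔ b) = dia a ⊔ dia b

namespace CBAO

attribute [instance] CBAO.str

instance : CoeSort CBAO.{u} (Type u) := ⟨CBAO.carrier⟩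

/-- A complete BAO homomorphism: a map that preserves arbitrary joins and meets (hence also
complements, see `CBAO.Hom.map_compl`) and commutes with the operators. -/
@[ext]
structure Hom (A B : CBAO.{u}) where
  toHom : CompleteLatticeHom A B
  map_dia : ∀ a : A, toHom (A.dia a) = B.dia (toHom a)

theorem Hom.map_compl {A B : CBAO.{u}} (f : Hom A B) (a : A) :
    f.toHom aᶜ = (f.toHom a)ᶜ :=
  map_compl' f.toHom a

/-- The identity homomorphism. -/
def Hom.id (A : CBAO.{u}) : Hom A A where
  toHom := CompleteLatticeHom.id A
  map_dia _ := rfl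

/-- The composite of two homomorphisms, `f` first. -/
def Hom.comp {A B C : CBAO.{u}} (f : Hom A B) (g : Hom B C) : Hom A C where
  toHom := g.toHom.comp f.toHom
  map_dia a := by
    simp only [CompleteLatticeHom.comp_apply, f.map_dia, g.map_dia]

/-- The category of complete BAOs and complete BAO homomorphisms. -/
instance : LargeCategory.{u} CBAO.{u} where
  Hom := Hom
  id := Hom.id
  comp := Hom.comp

/-- A closure algebra: a BAO with `a ≤ ◇a` and `◇◇a ≤ ◇a` for all `a`. -/
def IsClosureAlgebra : ObjectProperty CBAO.{u} := fun A =>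
  ∀ a : A, a ≤ A.dia a ∧ A.dia (A.dia a) ≤ A.dia a

end CBAO

/-- The full subcategory of `CBAO` consisting of closure algebras. -/
abbrev CCA : Type (u + 1) := CBAO.IsClosureAlgebra.{u}.FullSubcategory

/-!
If `C` were a coproduct of `A` with itself, then any pair of homomorphisms `f g : A ⟶ D` would
factor through `C`, so the range of the induced map `C ⟶ D` would be a complete subalgebra of `D`,
closed under the operator and containing the ranges of `f` and `g`. It therefore suffices to find
one closure algebra `A` such that arbitrarily large closure algebras are generated by two
homomorphic images of `A`. One argument then serves both categories.

For `A` take the four-element closure algebra in which every nonzero element has closure `⊤`; it is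
the powerset algebra of a two-point frame with the total relation. A homomorphism from `A` to the
powerset algebra of a preordered set is a two-colouring such that every point sees both colours.
The large algebras are powersets of the frames `Ladder W`, where `W` is a well-ordered set:
two copies of `W`, each of the two points on level `w` seeing itself and all points on lower levels,
together with two points (the base) seen by everyone. The two colourings agree on the levels, where
they tell the two copies apart, and disagree on the base, so together they supply all four colours.
If `V` is the set of level points on levels `≥ w`, then the point of colour `i` on level `w` is the
only point of `V` of colour `i` that does not see a point of `V` of colour `!i`. By well-founded
induction along `W` all these points are thus generated (`singleton_mem_range`), so the generated
algebra surjects onto `Set W`. With `W` a well-ordering of `C` itself, this contradicts Cantor's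
theorem.
-/

open Set

/-- The complex algebra of a Kripke frame `(X, R)`: the powerset of `X`, with `◇S` the set of points
that see an element of `S`. -/
def complexAlgebra {X : Type u} (R : X → X → Prop) : CBAO.{u} where
  carrier := Set X
  dia S := {x | ∃ y ∈ S, R x y}
  dia_bot := by
    ext x
    simp
  dia_sup S T := by
    ext x
    simp only [mem_ofPred_eq, sup_eq_union, mem_union, or_and_right, exists_or]

theorem isClosureAlgebra_complexAlgebra {X : Type u} {R : X → X → Prop}
    (hrefl : ∀ x, R x x) (htrans : ∀ x y z, R x y → R y z → R x z) :
    (complexAlgebra R).IsClosureAlgebra := by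
  intro (S : Set X)
  constructor
  · intro x hx
    exact ⟨x, hx, hrefl x⟩
  · rintro x ⟨y, ⟨z, hz, hyz⟩, hxy⟩
    exact ⟨z, hz, htrans x y z hxy hyz⟩

/-- The frame on two points that see each other and themselves, as a complex algebra. -/
def totalPair : CBAO.{u} :=
  complexAlgebra (X := ULift.{u} Bool) fun _ _ => True

theorem isClosureAlgebra_totalPair : totalPair.{u}.IsClosureAlgebra :=
  isClosureAlgebra_complexAlgebra (fun _ => trivial) (fun _ _ _ _ _ => trivial)

/-- A two-colouring of a frame in which every point sees both colours is a bounded morphism to the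
total frame on two points; taking preimages gives a homomorphism of complex algebras. -/
def colouringHom {X : Type u} (R : X → X → Prop) (c : X → Bool)
    (hc : ∀ x i, ∃ y, R x y ∧ c y = i) : totalPair.{u} ⟶ complexAlgebra R :=
  CBAO.Hom.mk (A := totalPair) (B := complexAlgebra R)
    (CompleteLatticeHom.setPreimage fun x => ULift.up (c x)) <| by
    intro (S : Set (ULift Bool))
    refine Set.ext fun x => ?_
    constructor
    · rintro ⟨⟨i⟩, hi, -⟩
      obtain ⟨y, hxy, rfl⟩ := hc x i
      exact ⟨y, hi, hxy⟩
    · rintro ⟨y, hy, -⟩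
      exact ⟨_, hy, trivial⟩

/-- Two points on each level `w : W`, distinguished by a Boolean, and two base points. -/
abbrev Ladder (W : Type u) : Type u := (W × Bool) ⊕ Bool

namespace Ladder

variable {W : Type u}

/-- A point on a level sees itself, everything on lower levels, and the base; the base points see
each other and themselves. -/
def Sees [LT W] : Ladder W → Ladder W → Prop
  | .inl p, .inl q => p = q ∨ q.1 < p.1
  | .inr _, .inl _ => False
  | _, .inr _ => True

theorem sees_refl [LT W] (x : Ladder W) : Sees x x := by
  cases x <;> simp [Sees]

theorem sees_trans [Preorder W] (x y z : Ladder W) (hxy : Sees x y) (hyz : Sees y z) :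
    Sees x z := by
  rcases x with p | i <;> rcases y with q | j <;> rcases z with r | k <;>
    simp only [Sees] at *
  rcases hxy with rfl | hxy
  · exact hyz
  · rcases hyz with rfl | hyz
    · exact .inr hxy
    · exact .inr (hyz.trans hxy)

/-- The first colouring. -/
def colour : Ladder W → Bool
  | .inl p => p.2
  | .inr j => j

/-- The second colouring, which differs from `colour` exactly on the base. -/
def colour' : Ladder W → Bool
  | .inl p => p.2
  | .inr j => !j

theorem exists_sees_colour [LT W] (x : Ladder W) (i : Bool) : ∃ y, Sees x y ∧ colour y = i :=
  ⟨.inr i, by cases x <;> simp [Sees], rfl⟩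

theorem exists_sees_colour' [LT W] (x : Ladder W) (i : Bool) : ∃ y, Sees x y ∧ colour' y = i :=
  ⟨.inr !i, by cases x <;> simp [Sees], by simp [colour']⟩

/-- A point on level `w` is definable from the points on lower levels and the colourings. -/
theorem singleton_eq [LinearOrder W] (w : W) (i : Bool) (V : Set (Ladder W))
    (hV : V = {x | colour x = colour' x} \ {x | ∃ p : W × Bool, p.1 < w ∧ x = .inl p}) :
    {.inl (w, i)} =
      (V ∩ {x | colour x = i}) \ {x | ∃ y ∈ V ∩ {x | colour x = !i}, Sees x y} := by
  have hinl (v : W) (j : Bool) : (.inl (v, j) : Ladder W) ∈ V ↔ w ≤ v := by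
    rw [hV, ← not_lt]
    refine ⟨fun h hv => h.2 ⟨(v, j), hv, rfl⟩, fun h => ⟨rfl, ?_⟩⟩
    rintro ⟨p, hp, hpv⟩
    obtain rfl := Sum.inl.inj hpv
    exact h hp
  have hinr (j : Bool) : (.inr j : Ladder W) ∉ V := by
    simp [hV, colour, colour']
  ext x
  rcases x with ⟨v, j⟩ | j
  · simp only [mem_singleton_iff, Sum.inl.injEq, Prod.mk.injEq, mem_sdiff, mem_inter_iff, hinl,
      mem_ofPred_eq, colour]
    constructor
    · rintro ⟨rfl, rfl⟩
      refine ⟨⟨le_rfl, rfl⟩, ?_⟩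
      rintro ⟨⟨u, k⟩ | k, ⟨hu, hk⟩, h⟩
      · rw [hinl] at hu
        rcases h with h | h
        · obtain ⟨-, rfl⟩ := Prod.mk.inj h
          simp at hk
        · exact absurd h hu.not_gt
      · exact hinr k hu
    · rintro ⟨⟨hv, rfl⟩, h⟩
      refine ⟨?_, rfl⟩
      by_contra hne
      exact h ⟨.inl (w, !j), ⟨(hinl _ _).2 le_rfl, rfl⟩, .inr (lt_of_le_of_ne hv (Ne.symm hne))⟩
  · simp [hinr]

/-- The complex algebra of a ladder. -/
abbrev algebra (W : Type u) [LT W] : CBAO.{u} := complexAlgebra (Sees (W := W))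

variable [LinearOrder W] [WellFoundedLT W] {C : CBAO.{u}}

/-- A subalgebra containing the colour classes contains every singleton on a level. -/
theorem singleton_mem_range (φ : CBAO.Hom C (algebra W))
    (hc : ∀ i, ∃ a, φ.toHom a = {x : Ladder W | colour x = i})
    (hc' : ∀ i, ∃ a, φ.toHom a = {x : Ladder W | colour' x = i}) (w : W) :
    ∀ i, ∃ a, φ.toHom a = ({.inl (w, i)} : Set (Ladder W)) := by
  induction w using WellFoundedLT.induction with
  | ind w ih =>
    choose e he using ih
    choose a ha using hc
    choose b hb using hc'
    have hU : φ.toHom (⨆ p : {p : W × Bool // p.1 < w}, e p.1.1 p.2 p.1.2) =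
        {x : Ladder W | ∃ p : W × Bool, p.1 < w ∧ x = .inl p} := by
      rw [map_iSup]
      simp only [he]
      change (⋃ p : {p : W × Bool // p.1 < w}, ({.inl p.1} : Set (Ladder W))) = _
      ext x
      simp only [mem_iUnion, mem_singleton_iff, Subtype.exists, exists_prop, mem_ofPred_eq]
    have hK : φ.toHom (a true ⊓ b true ⊔ a false ⊓ b false) =
        {x : Ladder W | colour x = colour' x} := by
      rw [map_sup, map_inf, map_inf, ha, ha, hb, hb]
      refine Set.ext fun x => ?_
      change (colour x = true ∧ colour' x = true) ∨ (colour x = false ∧ colour' x = false) ↔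
        colour x = colour' x
      cases colour x <;> cases colour' x <;> simp
    intro i
    have hV := congrArg₂ (fun S T : Set (Ladder W) => S ∩ Tᶜ) hK hU
    generalize a true ⊓ b true ⊔ a false ⊓ b false = k at hV
    generalize (⨆ p : {p : W × Bool // p.1 < w}, e p.1.1 p.2 p.1.2) = u at hV
    refine ⟨(k ⊓ uᶜ) ⊓ a i ⊓ (C.dia ((k ⊓ uᶜ) ⊓ a !i))ᶜ, ?_⟩
    simp only [map_inf, φ.map_compl, φ.map_dia, ha]
    exact (singleton_eq w i _ hV).symm

/-- Arbitrary unions of the singletons provided by `singleton_mem_range` give all of `Set W`. -/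
theorem exists_surjective (φ : CBAO.Hom C (algebra W))
    (hc : ∀ i, ∃ a, φ.toHom a = {x : Ladder W | colour x = i})
    (hc' : ∀ i, ∃ a, φ.toHom a = {x : Ladder W | colour' x = i}) :
    ∃ f : C → Set W, Function.Surjective f := by
  choose e he using singleton_mem_range φ hc hc'
  refine ⟨fun a => (fun w => (.inl (w, true) : Ladder W)) ⁻¹' φ.toHom a, fun S => ?_⟩
  have hS : φ.toHom (⨆ w : S, e w true) = ⋃ w : S, ({.inl (w.1, true)} : Set (Ladder W)) := by
    rw [map_iSup]
    simp only [he]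
    rfl
  refine ⟨⨆ w : S, e w true, ?_⟩
  refine (congrArg (fun T : Set (Ladder W) => (fun w => .inl (w, true)) ⁻¹' T) hS).trans ?_
  ext v
  simp

end Ladder

/-- No algebra receives two homomorphisms from `totalPair` through which all pairs of homomorphisms
to closure algebras factor; uniqueness of the factorization plays no role. -/
theorem not_weak_coproduct_totalPair (C : CBAO.{u}) (ι ι' : totalPair ⟶ C) :
    ¬ ∀ D : CBAO.{u}, D.IsClosureAlgebra → ∀ f g : totalPair ⟶ D,
      ∃ φ : C ⟶ D, ι ≫ φ = f ∧ ι' ≫ φ = g := by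
  intro h
  -- Quantifying over `W` keeps the well-ordering apart from the lattice order of `C`.
  have key (W : Type u) [LinearOrder W] [WellFoundedLT W] :
      ∃ f : C → Set W, Function.Surjective f := by
    obtain ⟨φ, hφ, hφ'⟩ := h (Ladder.algebra W)
      (isClosureAlgebra_complexAlgebra Ladder.sees_refl Ladder.sees_trans)
      (colouringHom _ Ladder.colour Ladder.exists_sees_colour)
      (colouringHom _ Ladder.colour' Ladder.exists_sees_colour')
    refine Ladder.exists_surjective φ
      (fun i => ⟨CBAO.Hom.toHom ι ({.up i} : Set (ULift Bool)), ?_⟩)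
      (fun i => ⟨CBAO.Hom.toHom ι' ({.up i} : Set (ULift Bool)), ?_⟩)
    · refine (congrArg (fun ψ => CBAO.Hom.toHom ψ ({.up i} : Set (ULift Bool))) hφ).trans ?_
      exact Set.ext fun x => ULift.up_inj
    · refine (congrArg (fun ψ => CBAO.Hom.toHom ψ ({.up i} : Set (ULift Bool))) hφ').trans ?_
      exact Set.ext fun x => ULift.up_inj
  obtain ⟨_, _⟩ := exists_wellFoundedLT C.carrier
  obtain ⟨f, hf⟩ := key C.carrier
  exact Function.cantor_surjective f hf

theorem theorem5p4 :
    ¬ HasBinaryCoproducts CBAO.{u} ∧ ¬ HasBinaryCoproducts CCA.{u} := by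
  constructor
  · intro h
    exact not_weak_coproduct_totalPair (totalPair ⨿ totalPair) coprod.inl coprod.inr
      fun D _ f g => ⟨coprod.desc f g, coprod.inl_desc f g, coprod.inr_desc f g⟩
  · intro h
    let A : CCA.{u} := ⟨totalPair, isClosureAlgebra_totalPair⟩
    refine not_weak_coproduct_totalPair (A ⨿ A).obj
      (coprod.inl : A ⟶ A ⨿ A).hom (coprod.inr : A ⟶ A ⨿ A).hom fun D hD f g => ?_
    let F : A ⟶ ⟨D, hD⟩ := ObjectProperty.homMk f
    let G : A ⟶ ⟨D, hD⟩ := ObjectProperty.homMk g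
    exact ⟨(coprod.desc F G).hom, congrArg (fun ψ => ψ.hom) (coprod.inl_desc F G),
      congrArg (fun ψ => ψ.hom) (coprod.inr_desc F G)⟩
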